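/- **Theorem.** Let $(X_1,Y_1),(X_2,Y_2),\dots$ be i.i.d. random pairs with values in $[0,1]^2$ almost surely, such that $X_1$ and $Y_1$ are continuous (neither has an atom) and $X_1$ is independent of $Y_1$. Let $B:\mathbb N\to\mathbb R$ satisfy $B(n)=O(n^{1-\varepsilon})$ for some $0<\varepsilon<1$ (for instance $B(n)=n^{0.6}$), and let $c>0$. Then for every $1\le p\le\infty$, $$\mathrm{ApproxGMIC}_p\big((X_1,\dots,X_n),(Y_1,\dots,Y_n)\big)\longrightarrow 0\quad\text{in probability as } n\to\infty .$$ Here $\mathrm{ApproxGMIC}_p$ is defined as follows. For a sample $D=\{(x_i,y_i)\}_{i=1}^n$ and integers $k,l\ge 2$ with $kl\le B(n)$, let $C_{k,l}=\max\{I_{k,l}(D),\,I_{l,k}(D^{\perp})\}/\log_2\min\{k,l\}$ be the approximate characteristic matrix computed by the algorithm of Reshef and Reshef with maximal grid size $B(n)$ and clump factor $c$, where $D^\perp=\{(y_i,x_i)\}_{i=1}^n$ and $I_{k,l}(D)$ ($k$ columns, $l$ rows) is computed thus: 1. The points are partitioned greedily, in increasing order of $y$, into at most $l$ consecutive rows $Q$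 of nearly equal sizes: a group of points with the same $y$-value is put into the current row, unless this row is nonempty and the addition would not bring its size strictly closer to the desired size; in that case a new row is opened. The desired size is initially $n/l$, and at the opening of each new row it becomes the number of unassigned points divided by the number of remaining rows. 2. In the order of $x$, the points are divided into clumps, the maximal runs of consecutive points lying in the same row (points with equal $x$-values are never separated; if they lie in different rows they form a clump of their own). If there are more than $\hat k=\max\{\lfloor c\lfloor B(n)/l\rfloor\rfloor,1\}$ clumps, consecutive clumps are merged into at most $\hat k$ superclumps by the greedy partition of step 1, applied to the clump indices with $\hat k$ in place of $l$. 3. $I_{k,l}(D)$ is the maximum, computed by dynamic programming, of the empirical mutual information (base $2$) $H(Q)+H(P)-H(P,Q)$ over all partitions $P$ of the points into $k$ columns that consist of consecutive (super)clumps (into as many columns as there are (super)clumps, if these are fewer than $k$). For $I_{l,k}(D^\perp)$ the roles of $x$ and $y$, and of $k$ and $l$, are exchanged; in particular $\hat k=\max\{\lfloor c\lfloor B(n)/k\rfloor\rfloor,1\}$. Put $C^*_{i,j}=\max\{C_{k,l}: k,l\ge2,\ kl\le ij\}$ and $Z=\#\{(i,j): i,j\ge 2,\ ij\le B(n)\}$.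 Then $$\mathrm{ApproxGMIC}_p=\Big(\frac1Z\sum_{i,j\ge2,\ ij\le B(n)}(C^*_{i,j})^p\Big)^{1/p}\quad(1\le p<\infty),\qquad \mathrm{ApproxGMIC}_\infty=\max_{i,j\ge 2,\ ij\le B(n)}C^*_{i,j},$$ and $\mathrm{ApproxGMIC}_p=0$ if there is no such pair $(i,j)$, that is, if $B(n)<4$. -/

import Mathlib

open MeasureTheory ProbabilityTheory Filter Topology
open scoped ENNReal

namespace MINE

/-- The largest value of `f` on the finite set `s` (and `0` if `s` is empty). -/
def finMax {ι β : Type*} [LinearOrder β] [Zero β] (s : Finset ι) (f : ι → β) : β :=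
  if h : s.Nonempty then s.sup' h f else 0

section Partitions

variable {n : ℕ} {α : Type*} [LinearOrder α]

/-- The number of sample points whose value is `a`. -/
def mult (v : Fin n → α) (a : α) : ℕ := (Finset.univ.filter fun i => v i = a).card

/-- Main loop of the greedy equipartition of a sample `v` into (at most) `m` rows.
The list holds the distinct values not yet treated, in increasing order; `placed` is the number
of points already assigned, `h` the number of points in the current row `row` (rows are numbered
from `0`), and `size` the desired size of the current row. All points with the value `a` go
to the same row: the current one, unless it is nonempty and adding them would not bring its size
strictly closer to the desired size; in that case a new row is opened, and the
desired size becomes the number of remaining points divided by the number of remaining rows.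
The result maps each listed value to its row. -/
def equipartitionLoop (v : Fin n → α) (m : ℕ) :
    List α → (placed h row : ℕ) → (size : ℚ) → α → ℕ
  | [], _, _, row, _ => fun _ => row
  | a :: l, placed, h, row, size =>
    if h ≠ 0 ∧ |(h : ℚ) - size| ≤ |(h : ℚ) + (mult v a : ℚ) - size| then
      Function.update
        (equipartitionLoop v m l (placed + mult v a) (mult v a) (row + 1)
          (((n : ℚ) - (placed : ℚ)) / ((m : ℚ) - ((row : ℚ) + 1)))) a (row + 1)
    else
      Function.update
        (equipartitionLoop v m l (placed + mult v a) (h + mult v a) row size) a row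

/-- `EquipartitionYAxis`: the row of each sample point when the sample `v` is greedily
partitioned into (at most) `m` consecutive rows of nearly equal sizes. -/
def equipartition (v : Fin n → α) (m : ℕ) (i : Fin n) : ℕ :=
  equipartitionLoop v m ((Finset.univ.image v).sort (· ≤ ·)) 0 0 0 ((n : ℚ) / (m : ℚ)) (v i)

/-- `a < b` are neighbouring values of the sample `u`. -/
def Neighbours (u : Fin n → α) (a b : α) : Prop :=
  (∃ i, u i = a) ∧ (∃ i, u i = b) ∧ a < b ∧ ∀ i, ¬ (a < u i ∧ u i < b)

/-- All sample points with `u`-value `a` or `b` lie in the same row of the partition `q`. -/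
def SameRow (u : Fin n → α) (q : Fin n → ℕ) (a b : α) : Prop :=
  ∀ i j, (u i = a ∨ u i = b) → (u j = a ∨ u j = b) → q i = q j

instance (u : Fin n → α) (a b : α) : Decidable (Neighbours u a b) := by
  unfold Neighbours; infer_instance

instance (u : Fin n → α) (q : Fin n → ℕ) (a b : α) : Decidable (SameRow u q a b) := by
  unfold SameRow; infer_instance

/-- `GetClumpsPartition`: the clump (numbered from `0`, in increasing order of `u`) of each sample
point. A clump is a maximal run of points, consecutive with respect to `u`, in the same row
of `q`; points with equal `u`-values are never separated, and if they lie in different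
rows they form a clump of their own. The number of a clump is the number of clump
boundaries to its left. -/
def clump (u : Fin n → α) (q : Fin n → ℕ) (i : Fin n) : ℕ :=
  ((Finset.univ.image u).filter fun b =>
    b ≤ u i ∧ ∃ j, Neighbours u (u j) b ∧ ¬ SameRow u q (u j) b).card

/-- The number of classes of a partition that is given by labels. -/
def numParts (P : Fin n → ℕ) : ℕ := (Finset.univ.image P).card

/-- `GetSuperclumpsPartition`: if there are more than `kmax` clumps, consecutive clumps are
merged into (at most) `kmax` superclumps, by an equipartition of the points that does not separate
points of the same clump. -/
def superclump (u : Fin n → α) (q : Fin n → ℕ) (kmax : ℕ) : Fin n → ℕ :=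
  if kmax < numParts (clump u q) then equipartition (clump u q) kmax else clump u q

end Partitions

noncomputable section

section Optimize

variable {n : ℕ}

/-- Shannon entropy (in bits) of the empirical distribution of the rows `q`. -/
def rowEntropy (q : Fin n → ℕ) : ℝ :=
  -∑ r ∈ Finset.univ.image q, ((mult q r : ℝ) / (n : ℝ)) * Real.logb 2 ((mult q r : ℝ) / (n : ℝ))

/-- The number of points in the column formed by the (super)clumps `s, …, t - 1` of `P`. -/
def colCount (P : Fin n → ℕ) (s t : ℕ) : ℕ :=
  (Finset.univ.filter fun i => s ≤ P i ∧ P i < t).card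

/-- The number of points in the cell of that column in row `r`. -/
def cellCount (P q : Fin n → ℕ) (s t r : ℕ) : ℕ :=
  (Finset.univ.filter fun i => s ≤ P i ∧ P i < t ∧ q i = r).card

/-- `∑_r #_r log (#_r / #)` for the column formed by the (super)clumps `s, …, t - 1`. -/
def colTerm (P q : Fin n → ℕ) (s t : ℕ) : ℝ :=
  ∑ r ∈ Finset.univ.image q,
    (cellCount P q s t r : ℝ) * Real.logb 2 ((cellCount P q s t r : ℝ) / (colCount P s t : ℝ))

/-- The table of the dynamic programme. `dpTable P q l t` is computed as the best
value of `H(columns) - H(columns, rows)` over all groupings of the first `t` (super)clumps of `P`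
into `l + 1` columns of consecutive (super)clumps (the entropies are those of the points in these
`t` (super)clumps). The last column consists of the (super)clumps `s, …, t - 1`.
If there are fewer (super)clumps than columns, no further column is added. -/
def dpTable (P q : Fin n → ℕ) : ℕ → ℕ → ℝ
  | 0, t => colTerm P q 0 t / (colCount P 0 t : ℝ)
  | l + 1, t =>
    if l + 2 ≤ t then
      finMax (Finset.Icc (l + 1) t) fun s =>
        ((colCount P 0 s : ℝ) / (colCount P 0 t : ℝ)) * dpTable P q l s
          + colTerm P q s t / (colCount P 0 t : ℝ)
    else dpTable P q l t

/-- `ApproxMaxMI`: the `v`-axis is equipartitioned into `y` rows, the points are grouped along the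
`u`-axis into at most `kmax` superclumps, and the dynamic programme computes the largest
mutual information `H(Q) + H(P) - H(P, Q)` over the groupings of the superclumps into `x`
columns. -/
def approxMaxMI (u v : Fin n → ℝ) (x y kmax : ℕ) : ℝ :=
  rowEntropy (equipartition v y) +
    dpTable (superclump u (equipartition v y) kmax) (equipartition v y) (x - 1)
      (numParts (superclump u (equipartition v y) kmax))

/-- The maximal number of superclumps when at most `x` columns are considered; `c` is the
clump factor of the algorithm. -/
def maxClumps (c : ℝ) (x : ℕ) : ℕ := max ⌊c * (x : ℝ)⌋₊ 1

/-- `ApproxCharacteristicMatrix`: the entry for `x` columns and `y` rows of the approximate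
characteristic matrix of the sample `(u i, v i)`, with maximal grid size `b` and clump
factor `c`. -/
def approxChar (b c : ℝ) (u v : Fin n → ℝ) (x y : ℕ) : ℝ :=
  max (approxMaxMI u v x y (maxClumps c ⌊b / (y : ℝ)⌋₊))
      (approxMaxMI v u y x (maxClumps c ⌊b / (x : ℝ)⌋₊))
    / Real.logb 2 (min x y : ℕ)

end Optimize

/-- The grid sizes `(k, l)` with `k, l ≥ 2` and `k * l ≤ N`. -/
def gridSizes (N : ℕ) : Finset (ℕ × ℕ) :=
  (Finset.Icc 2 N ×ˢ Finset.Icc 2 N).filter fun kl => kl.1 * kl.2 ≤ N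

/-- The maximal characteristic matrix `C*_{i,j} = max_{kl ≤ ij} C_{k,l}` of a matrix `C`. -/
def maximalChar (C : ℕ → ℕ → ℝ) (i j : ℕ) : ℝ :=
  finMax (gridSizes (i * j)) fun kl => C kl.1 kl.2

/-- `GMIC_p`, for `1 ≤ p ≤ ∞`, computed from the characteristic matrix `C` with maximal grid
size `b`: the `p`-th power mean (the maximum, if `p = ∞`) of the `C*_{i,j}`, `ij ≤ b`.
If there is no such pair, that is if `b < 4`, the value is `0`. -/
def gmic (p : ℝ≥0∞) (b : ℝ) (C : ℕ → ℕ → ℝ) : ℝ :=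
  if p = ∞ then
    finMax (gridSizes ⌊b⌋₊) fun ij => maximalChar C ij.1 ij.2
  else
    ((1 / ((gridSizes ⌊b⌋₊).card : ℝ)) *
      ∑ ij ∈ gridSizes ⌊b⌋₊, maximalChar C ij.1 ij.2 ^ p.toReal) ^ (1 / p.toReal)

/-- `ApproxGMIC_p` of the sample `(u i, v i)`. -/
def approxGMIC {n : ℕ} (p : ℝ≥0∞) (b c : ℝ) (u v : Fin n → ℝ) : ℝ :=
  gmic p b (approxChar b c u v)

end

end MINE

-- Whatever the equipartition and the superclumps do, `n` times the output of the optimisation is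
-- exactly `infoSum` of an actual grid with monotone labels (`exists_approxMaxMI_eq`). Hence it
-- suffices to show that, with high probability, no grid with `kl ≤ B(n)` has mutual information at
-- least `δ/2`. The quality of the greedy choices plays no role.
--
-- A sample of `n` points has at most `(n+1)^k` monotone labelings with `k` labels
-- (`card_monoLabel_le`), so a union bound over all grids is affordable. For a single grid,
-- independence of the two coordinate samples and exchangeability of the second allow the row
-- labeling `b` to be replaced by `b ∘ σ` with `σ` a uniform permutation. By the method of types,
-- the mean of `2 ^ infoSum` over `σ` is at most `(e(n+1))^l (n+1)^(kl)`
-- (`sum_perm_two_rpow_infoSum_le`).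
--
-- An exponential Markov bound then gives probability at most `(n+1)^(k+l) (e(n+1))^l (n+1)^(kl)
-- 2^(-nδ/2)` for one grid size (`measureReal_highInfo_le`). Summed over `kl ≤ B(n) = O(n^(1-ε))`,
-- the prefactor is `exp(O(B(n) log n)) = exp(o(n))`, which the exponential factor beats
-- (`tendsto_pow_mul_two_rpow`).

namespace MINE

-- Empirical mutual information as a sum over points.

section Labelings

variable {ι α β : Type*} [Fintype ι] [DecidableEq α] [DecidableEq β]

/-- The number of points that have the same label as the point `i`. -/
def fiberCard (a : ι → α) (i : ι) : ℕ := (Finset.univ.filter fun j => a j = a i).card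

lemma fiberCard_pos (a : ι → α) (i : ι) : 0 < fiberCard a i :=
  Finset.card_pos.2 ⟨i, by simp⟩

lemma fiberCard_comp_of_injective {f : α → β} (hf : Function.Injective f) (a : ι → α) (i : ι) :
    fiberCard (fun j => f (a j)) i = fiberCard a i := by
  simp [fiberCard, hf.eq_iff]

/-- The empirical mutual information (in bits) of the labelings `a` and `b`, multiplied by the
number of points. -/
noncomputable def infoSum (a : ι → α) (b : ι → β) : ℝ :=
  ∑ i, Real.logb 2 ((Fintype.card ι : ℝ) * fiberCard (fun j => (a j, b j)) i /
    (fiberCard a i * fiberCard b i))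

lemma infoSum_comm (a : ι → α) (b : ι → β) : infoSum a b = infoSum b a := by
  unfold infoSum
  refine Finset.sum_congr rfl fun i _ => ?_
  have : fiberCard (fun j => (a j, b j)) i = fiberCard (fun j => (b j, a j)) i := by
    simp [fiberCard, and_comm]
  rw [this, mul_comm (fiberCard a i : ℝ)]

lemma infoSum_comp_of_injective {α' β' : Type*} [DecidableEq α'] [DecidableEq β']
    {f : α → α'} {g : β → β'} (hf : Function.Injective f) (hg : Function.Injective g)
    (a : ι → α) (b : ι → β) :
    infoSum (fun j => f (a j)) (fun j => g (b j)) = infoSum a b := by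
  unfold infoSum
  refine Finset.sum_congr rfl fun i _ => ?_
  have h : fiberCard (fun j => (f (a j), g (b j))) i = fiberCard (fun j => (a j, b j)) i :=
    fiberCard_comp_of_injective (hf.prodMap hg) (fun j => (a j, b j)) i
  rw [fiberCard_comp_of_injective hf, fiberCard_comp_of_injective hg, h]

/-- Weighting each point by the reciprocal of its class size counts every occupied label once. -/
lemma sum_comp_div_fiberCard (a : ι → α) (F : α → ℝ) :
    ∑ i, F (a i) / fiberCard a i = ∑ x ∈ Finset.univ.image a, F x := by
  rw [← Finset.sum_fiberwise_of_maps_to (t := Finset.univ.image a) (g := a)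
    (fun i _ => Finset.mem_image_of_mem a (Finset.mem_univ i))]
  refine Finset.sum_congr rfl fun x hx => ?_
  obtain ⟨i, -, rfl⟩ := Finset.mem_image.1 hx
  have h : ∀ j ∈ Finset.univ.filter (fun j => a j = a i),
      F (a j) / fiberCard a j = F (a i) / fiberCard a i := by
    intro j hj
    have := (Finset.mem_filter.1 hj).2
    simp [fiberCard, this]
  rw [Finset.sum_congr rfl h, Finset.sum_const, nsmul_eq_mul]
  have := fiberCard_pos a i
  change (fiberCard a i : ℝ) * _ = _
  field_simp

/-- Apply `log x ≥ 1 - 1/x` to each point. The reciprocals sum to `1/n` times the sum, over occupied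
cells, of row size times column size, and over all cells that sum of products is `n * n`. -/
lemma infoSum_nonneg (a : ι → α) (b : ι → β) : 0 ≤ infoSum a b := by
  rcases isEmpty_or_nonempty ι with h | h
  · simp [infoSum]
  have hn : (0 : ℝ) < Fintype.card ι := by exact_mod_cast Fintype.card_pos
  set A : α → ℝ := fun x => (Finset.univ.filter fun j => a j = x).card
  set C : β → ℝ := fun x => (Finset.univ.filter fun j => b j = x).card
  have hA : ∀ i, (fiberCard a i : ℝ) = A (a i) := fun i => rfl
  have hC : ∀ i, (fiberCard b i : ℝ) = C (b i) := fun i => rfl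
  have hsA : ∑ x ∈ Finset.univ.image a, A x = Fintype.card ι := by
    have := Finset.card_eq_sum_card_image a (Finset.univ : Finset ι)
    rw [Finset.card_univ] at this
    rw [this]; push_cast; rfl
  have hsC : ∑ x ∈ Finset.univ.image b, C x = Fintype.card ι := by
    have := Finset.card_eq_sum_card_image b (Finset.univ : Finset ι)
    rw [Finset.card_univ] at this
    rw [this]; push_cast; rfl
  have key : ∑ i, A (a i) * C (b i) / fiberCard (fun j => (a j, b j)) i
      ≤ (Fintype.card ι : ℝ) * Fintype.card ι := by
    rw [sum_comp_div_fiberCard (fun j => (a j, b j)) (fun z => A z.1 * C z.2)]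
    calc _ ≤ ∑ z ∈ Finset.univ.image a ×ˢ Finset.univ.image b, A z.1 * C z.2 := by
          refine Finset.sum_le_sum_of_subset_of_nonneg ?_ fun _ _ _ => by positivity
          intro z hz
          obtain ⟨i, -, rfl⟩ := Finset.mem_image.1 hz
          simp
      _ = _ := by rw [Finset.sum_product, ← Finset.sum_mul_sum, hsA, hsC]
  have hterm : ∀ i, (1 - A (a i) * C (b i) / fiberCard (fun j => (a j, b j)) i
      / Fintype.card ι) / Real.log 2 ≤
      Real.logb 2 ((Fintype.card ι : ℝ) * fiberCard (fun j => (a j, b j)) i /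
        (fiberCard a i * fiberCard b i)) := by
    intro i
    have h1 : (0 : ℝ) < fiberCard a i := by exact_mod_cast fiberCard_pos a i
    have h2 : (0 : ℝ) < fiberCard b i := by exact_mod_cast fiberCard_pos b i
    have h3 : (0 : ℝ) < fiberCard (fun j => (a j, b j)) i := by
      exact_mod_cast fiberCard_pos (fun j => (a j, b j)) i
    rw [← hA, ← hC, Real.logb]
    refine div_le_div_of_nonneg_right ?_ (Real.log_pos one_lt_two).le
    refine le_trans (le_of_eq ?_) (Real.one_sub_inv_le_log_of_pos (by positivity))
    field_simp
  refine le_trans ?_ (Finset.sum_le_sum fun i _ => hterm i)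
  rw [← Finset.sum_div, Finset.sum_sub_distrib, ← Finset.sum_div]
  refine div_nonneg ?_ (Real.log_pos one_lt_two).le
  rw [Finset.sum_const, Finset.card_univ, nsmul_eq_mul, mul_one, sub_nonneg, div_le_iff₀ hn]
  exact key

end Labelings

-- Exponential moment of the mutual information under a random permutation.

section Permutations

variable {ι κ : Type*} [Fintype ι] [DecidableEq ι] [Fintype κ] [DecidableEq κ]

/-- If some `τ` carries `b` to `c`, then `σ ↦ σ * τ⁻¹` maps all such permutations injectively into
the stabilizer of `b`, whose order is the product of factorials. -/
lemma card_perm_comp_eq_le (b c : ι → κ) :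
    (Finset.univ.filter fun σ : Equiv.Perm ι => (fun i => b (σ i)) = c).card ≤
      ∏ s, (Finset.univ.filter fun i => b i = s).card.factorial := by
  rcases (Finset.univ.filter fun σ : Equiv.Perm ι =>
    (fun i => b (σ i)) = c).eq_empty_or_nonempty with h | ⟨τ, hτ⟩
  · simp [h]
  have hτ' := (Finset.mem_filter.1 hτ).2
  have hs := DomMulAct.stabilizer_card (α := ι) (ι := κ) b
  simp only [Fintype.card_subtype] at hs
  rw [← hs]
  refine Finset.card_le_card_of_injOn (fun σ => σ * τ⁻¹) ?_ ?_
  · intro σ hσ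
    have hσ' := (Finset.mem_filter.1 hσ).2
    simp only [Finset.coe_filter, Finset.mem_univ, true_and, Set.mem_ofPred_eq]
    funext i
    have := congrFun (hσ'.trans hτ'.symm) (τ⁻¹ i)
    simpa using this
  · intro σ _ σ' _ h
    exact mul_right_cancel h

/-- Group the permutations by `b ∘ σ`, then let the labeling range over all functions, so that the
sum of products factorises. -/
lemma sum_perm_prod_le (W : ι → κ → ℝ) (hW : ∀ i s, 0 ≤ W i s) (b : ι → κ) :
    ∑ σ : Equiv.Perm ι, ∏ i, W i (b (σ i)) ≤
      (∏ s, ((Finset.univ.filter fun i => b i = s).card.factorial : ℝ)) * ∏ i, ∑ s, W i s := by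
  rw [Finset.prod_univ_sum, Fintype.piFinset_univ, Finset.mul_sum,
    ← Finset.sum_fiberwise (s := (Finset.univ : Finset (Equiv.Perm ι)))
      (g := fun σ => fun i => b (σ i))]
  refine Finset.sum_le_sum fun c _ => ?_
  have : ∀ σ ∈ Finset.univ.filter (fun σ : Equiv.Perm ι => (fun i => b (σ i)) = c),
      ∏ i, W i (b (σ i)) = ∏ i, W i (c i) := by
    intro σ hσ
    have h := (Finset.mem_filter.1 hσ).2
    simp [← h]
  rw [Finset.sum_congr rfl this, Finset.sum_const, nsmul_eq_mul]
  refine mul_le_mul_of_nonneg_right ?_ (Finset.prod_nonneg fun i _ => hW _ _)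
  exact_mod_cast card_perm_comp_eq_le b c

/-- A Stirling bound, by induction from `e m^(m+1) ≤ (m+1)^(m+1)`. The factor `m + 1` in place of
`m` only serves to include `m = 0`. -/
lemma factorial_mul_exp_le (m : ℕ) :
    (m.factorial : ℝ) * Real.exp m ≤ Real.exp 1 * (m + 1) * (m : ℝ) ^ m := by
  rcases Nat.eq_zero_or_pos m with rfl | hm
  · simp
  suffices h : (m.factorial : ℝ) * Real.exp m ≤ Real.exp 1 * m * (m : ℝ) ^ m by
    refine h.trans ?_
    gcongr
    simp
  induction m, hm using Nat.le_induction with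
  | base => simp
  | succ m hm ih =>
    have hm0 : (0 : ℝ) < m := by exact_mod_cast hm
    have key : Real.exp 1 * (m : ℝ) ^ (m + 1) ≤ ((m : ℝ) + 1) ^ (m + 1) := by
      have h1 : (m : ℝ) / (m + 1) ≤ Real.exp (-(1 / ((m : ℝ) + 1))) := by
        refine le_trans (le_of_eq ?_) (Real.add_one_le_exp _)
        field_simp
        ring
      have h2 : ((m : ℝ) / (m + 1)) ^ (m + 1) ≤ Real.exp (-1) := by
        refine (pow_le_pow_left₀ (by positivity) h1 _).trans (le_of_eq ?_)
        rw [← Real.exp_nat_mul]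
        congr 1
        push_cast
        field_simp
      rw [div_pow, div_le_iff₀ (by positivity), Real.exp_neg] at h2
      have he := Real.exp_pos 1
      calc Real.exp 1 * (m : ℝ) ^ (m + 1)
          ≤ Real.exp 1 * ((Real.exp 1)⁻¹ * ((m : ℝ) + 1) ^ (m + 1)) := by gcongr
        _ = _ := by field_simp
    rw [Nat.factorial_succ]
    push_cast
    rw [Real.exp_add]
    calc ((m : ℝ) + 1) * m.factorial * (Real.exp m * Real.exp 1)
        = (m + 1) * Real.exp 1 * (m.factorial * Real.exp m) := by ring
      _ ≤ (m + 1) * Real.exp 1 * (Real.exp 1 * m * (m : ℝ) ^ m) := by gcongr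
      _ = Real.exp 1 * (m + 1) * (Real.exp 1 * (m : ℝ) ^ (m + 1)) := by ring
      _ ≤ Real.exp 1 * (m + 1) * ((m : ℝ) + 1) ^ (m + 1) := by gcongr

lemma pow_self_le_factorial_mul_exp (m : ℕ) :
    (m : ℝ) ^ m ≤ m.factorial * Real.exp m := by
  have := Real.pow_div_factorial_le_exp (x := m) (Nat.cast_nonneg m) m
  rwa [div_le_iff₀ (by positivity), mul_comm] at this

variable {γ : Type*} [Fintype γ] [DecidableEq γ]

omit [DecidableEq ι] [Fintype κ] [Fintype γ] in
lemma two_rpow_infoSum (a : ι → γ) (b : ι → κ) :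
    (2 : ℝ) ^ infoSum a b = ∏ i, ((Fintype.card ι : ℝ) * fiberCard (fun j => (a j, b j)) i /
      (fiberCard a i * fiberCard b i)) := by
  unfold infoSum
  rw [Real.rpow_sum_of_pos two_pos]
  refine Finset.prod_congr rfl fun i _ => ?_
  have h0 : 0 < Fintype.card ι := Fintype.card_pos_iff.2 ⟨i⟩
  have h1 := fiberCard_pos a i
  have h2 := fiberCard_pos b i
  have h3 := fiberCard_pos (fun j => (a j, b j)) i
  exact Real.rpow_logb two_pos (by norm_num) (by positivity)

omit [DecidableEq ι] [Fintype κ] in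
lemma fiberCard_comp_perm (b : ι → κ) (σ : Equiv.Perm ι) (i : ι) :
    fiberCard (fun j => b (σ j)) i = fiberCard b (σ i) := by
  unfold fiberCard
  refine Finset.card_bij (fun j _ => σ j) ?_ ?_ ?_
  · simp
  · simp
  · intro j hj
    exact ⟨σ.symm j, by simpa using hj, by simp⟩

/-- The conditional distribution of the column of a contingency table given its row. -/
noncomputable def rowKernel (T : γ → κ → ℕ) (r : γ) (s : κ) : ℝ :=
  (T r s : ℝ) / ∑ s', (T r s' : ℝ)

omit [DecidableEq κ] [Fintype γ] [DecidableEq γ] in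
lemma rowKernel_nonneg (T : γ → κ → ℕ) (r : γ) (s : κ) : 0 ≤ rowKernel T r s := by
  unfold rowKernel; positivity

omit [DecidableEq κ] [Fintype γ] [DecidableEq γ] in
-- Only an inequality, because an empty row gives `0 / 0 = 0`; a substochastic kernel is all that is
-- needed.
lemma sum_rowKernel_le_one (T : γ → κ → ℕ) (r : γ) : ∑ s, rowKernel T r s ≤ 1 := by
  unfold rowKernel
  rw [← Finset.sum_div]
  exact div_self_le_one _

/-- The contingency table of two labelings. -/
def contingency (a : ι → γ) (b : ι → κ) (r : γ) (s : κ) : Fin (Fintype.card ι + 1) :=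
  ⟨(Finset.univ.filter fun j => a j = r ∧ b j = s).card,
    Nat.lt_succ_of_le (Finset.card_le_univ _)⟩

omit [DecidableEq ι] [Fintype γ] in
lemma rowKernel_contingency (a : ι → γ) (b : ι → κ) (i : ι) :
    rowKernel (fun r s => (contingency a b r s : ℕ)) (a i) (b i) =
      fiberCard (fun j => (a j, b j)) i / fiberCard a i := by
  unfold rowKernel contingency fiberCard
  congr 1
  · simp
  · have := Finset.card_eq_sum_card_fiberwise (f := b) (s := Finset.univ.filter fun j => a j = a i)
      (t := Finset.univ) (fun _ _ => Finset.mem_coe.2 (Finset.mem_univ _))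
    rw [this]
    push_cast
    simp [Finset.filter_filter]

omit [DecidableEq ι] in
lemma prod_fiberCard (b : ι → κ) :
    ∏ i, (fiberCard b i : ℝ) = ∏ s, ((Finset.univ.filter fun i => b i = s).card : ℝ) ^
      (Finset.univ.filter fun i => b i = s).card := by
  rw [← Finset.prod_fiberwise (s := (Finset.univ : Finset ι)) (g := b)]
  refine Finset.prod_congr rfl fun s _ => ?_
  rw [← Finset.prod_const]
  refine Finset.prod_congr rfl fun i hi => ?_
  simp [fiberCard, (Finset.mem_filter.1 hi).2]

omit [DecidableEq ι] in
-- Compares the multinomial coefficient with its entropy approximation: `n^n ≤ n! e^n`, and the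
-- Stirling bound for each class, whose factors `e^m` multiply to `e^n`.
lemma prod_factorial_le (b : ι → κ) :
    (Fintype.card ι : ℝ) ^ Fintype.card ι *
      (∏ s, ((Finset.univ.filter fun i => b i = s).card.factorial : ℝ)) ≤
    (Fintype.card ι).factorial * (Real.exp 1 * (Fintype.card ι + 1)) ^ Fintype.card κ *
      ∏ i, (fiberCard b i : ℝ) := by
  have hsum : ∑ s, ((Finset.univ.filter fun i => b i = s).card : ℝ) = Fintype.card ι := by
    have := Finset.card_eq_sum_card_fiberwise (f := b) (s := (Finset.univ : Finset ι))
      (t := Finset.univ) (fun _ _ => Finset.mem_coe.2 (Finset.mem_univ _))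
    rw [← Finset.card_univ, this]; push_cast; rfl
  have h1 : (∏ s, ((Finset.univ.filter fun i => b i = s).card.factorial : ℝ)) *
      Real.exp (Fintype.card ι) ≤
      (Real.exp 1 * (Fintype.card ι + 1)) ^ Fintype.card κ * ∏ i, (fiberCard b i : ℝ) := by
    rw [← hsum, Real.exp_sum, ← Finset.prod_mul_distrib, prod_fiberCard, hsum, ← Finset.card_univ
      (α := κ), ← Finset.prod_const, ← Finset.prod_mul_distrib]
    refine Finset.prod_le_prod (fun s _ => by positivity) fun s _ => ?_
    refine (factorial_mul_exp_le _).trans ?_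
    gcongr
    exact Finset.card_le_univ _
  calc _ ≤ ((Fintype.card ι).factorial * Real.exp (Fintype.card ι)) *
        (∏ s, ((Finset.univ.filter fun i => b i = s).card.factorial : ℝ)) := by
        gcongr
        exact pow_self_le_factorial_mul_exp _
    _ = (Fintype.card ι).factorial *
        ((∏ s, ((Finset.univ.filter fun i => b i = s).card.factorial : ℝ)) *
          Real.exp (Fintype.card ι)) := by ring
    _ ≤ (Fintype.card ι).factorial * ((Real.exp 1 * (Fintype.card ι + 1)) ^ Fintype.card κ *
          ∏ i, (fiberCard b i : ℝ)) := by gcongr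
    _ = _ := by ring

/-- Method of types. The exponential of the information is a constant `D` times the likelihood of
the permuted labels under the kernel of their own contingency table. Summing over all tables removes
the dependence of the kernel on `σ`, at the cost of the number of tables, `(n+1)^(|γ||κ|)`. -/
theorem sum_perm_two_rpow_infoSum_le (a : ι → γ) (b : ι → κ) :
    ∑ σ : Equiv.Perm ι, (2 : ℝ) ^ infoSum a (fun i => b (σ i)) ≤
      (Fintype.card ι).factorial * (Real.exp 1 * (Fintype.card ι + 1)) ^ Fintype.card κ *
        ((Fintype.card ι : ℝ) + 1) ^ (Fintype.card γ * Fintype.card κ) := by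
  have hb : 0 < ∏ i, (fiberCard b i : ℝ) :=
    Finset.prod_pos fun i _ => by exact_mod_cast fiberCard_pos b i
  set D : ℝ := (Fintype.card ι : ℝ) ^ Fintype.card ι / ∏ i, (fiberCard b i : ℝ) with hD
  have hD0 : 0 ≤ D := by positivity
  -- The actual table of `a` and `b ∘ σ` is one of the summands, and there equality holds.
  have h1 : ∀ σ : Equiv.Perm ι, (2 : ℝ) ^ infoSum a (fun i => b (σ i)) ≤
      ∑ T : γ → κ → Fin (Fintype.card ι + 1),
        D * ∏ i, rowKernel (fun r s => (T r s : ℕ)) (a i) (b (σ i)) := by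
    intro σ
    refine le_trans (le_of_eq ?_) (Finset.single_le_sum (f := fun T : γ → κ →
      Fin (Fintype.card ι + 1) => D * ∏ i, rowKernel (fun r s => (T r s : ℕ)) (a i) (b (σ i)))
      (fun T _ => mul_nonneg hD0 (Finset.prod_nonneg fun i _ => rowKernel_nonneg _ _ _))
      (Finset.mem_univ (contingency a fun i => b (σ i))))
    rw [two_rpow_infoSum]
    have hp : ∏ i, (fiberCard b i : ℝ) = ∏ i, (fiberCard (fun i => b (σ i)) i : ℝ) := by
      rw [← Equiv.prod_comp σ]
      exact Finset.prod_congr rfl fun i _ => by rw [fiberCard_comp_perm]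
    have hc : (Fintype.card ι : ℝ) ^ Fintype.card ι = ∏ _i : ι, (Fintype.card ι : ℝ) := by
      simp
    rw [hD, hp, hc, ← Finset.prod_div_distrib, ← Finset.prod_mul_distrib]
    refine Finset.prod_congr rfl fun i _ => ?_
    rw [rowKernel_contingency a (fun i => b (σ i)) i, div_mul_div_comm,
      mul_comm (fiberCard a i : ℝ)]
  refine (Finset.sum_le_sum fun σ _ => h1 σ).trans ?_
  rw [Finset.sum_comm]
  have h2 : ∀ T : γ → κ → Fin (Fintype.card ι + 1),
      ∑ σ : Equiv.Perm ι, D * ∏ i, rowKernel (fun r s => (T r s : ℕ)) (a i) (b (σ i)) ≤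
      (Fintype.card ι).factorial * (Real.exp 1 * (Fintype.card ι + 1)) ^ Fintype.card κ := by
    intro T
    rw [← Finset.mul_sum]
    have h3 : ∑ σ : Equiv.Perm ι, ∏ i, rowKernel (fun r s => (T r s : ℕ)) (a i) (b (σ i)) ≤
        ∏ s, ((Finset.univ.filter fun i => b i = s).card.factorial : ℝ) := by
      refine (sum_perm_prod_le (fun i s => rowKernel (fun r s => (T r s : ℕ)) (a i) s)
        (fun i s => rowKernel_nonneg _ _ _) b).trans ?_
      refine mul_le_of_le_one_right (by positivity) ?_
      exact Finset.prod_le_one (fun i _ => Finset.sum_nonneg fun s _ => rowKernel_nonneg _ _ _)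
        fun i _ => sum_rowKernel_le_one _ _
    refine (mul_le_mul_of_nonneg_left h3 hD0).trans ?_
    rw [hD, div_mul_eq_mul_div, div_le_iff₀ hb]
    exact prod_factorial_le b
  refine (Finset.sum_le_sum fun T _ => h2 T).trans (le_of_eq ?_)
  rw [Finset.sum_const, Finset.card_univ, nsmul_eq_mul, mul_comm]
  congr 1
  simp only [Fintype.card_fun, Fintype.card_fin]
  push_cast
  rw [← pow_mul, mul_comm]

end Permutations

-- Counting monotone labelings.

section Monotone

variable {ι : Type*} [Fintype ι]

/-- The label of a point is a nondecreasing function of its value. -/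
def MonoLabel {α β : Type*} [LE α] [LE β] (x : ι → α) (a : ι → β) : Prop :=
  ∀ i j, x i ≤ x j → a i ≤ a j

/-- The sublevel sets of a monotone labeling are initial segments in the order of `x`. Two initial
segments are nested, so equal cardinality makes them equal. -/
lemma MonoLabel.eq_of_card_eq {α : Type*} [LinearOrder α] {k : ℕ} {x : ι → α} {a b : ι → Fin k}
    (ha : MonoLabel x a) (hb : MonoLabel x b)
    (h : ∀ s, (Finset.univ.filter fun i => a i ≤ s).card =
      (Finset.univ.filter fun i => b i ≤ s).card) : a = b := by
  have key : ∀ s, (Finset.univ.filter fun i => a i ≤ s) = Finset.univ.filter fun i => b i ≤ s := by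
    intro s
    by_cases hs : (Finset.univ.filter fun i => a i ≤ s) ⊆ Finset.univ.filter fun i => b i ≤ s
    · exact Finset.eq_of_subset_of_card_le hs (h s).ge
    · refine (Finset.eq_of_subset_of_card_le ?_ (h s).le).symm
      obtain ⟨i, hi, hi'⟩ := Finset.not_subset.1 hs
      simp only [Finset.mem_filter, Finset.mem_univ, true_and, not_le] at hi hi'
      intro j hj
      simp only [Finset.mem_filter, Finset.mem_univ, true_and] at hj ⊢
      rcases le_total (x i) (x j) with hij | hij
      · exact absurd (hb i j hij) (not_le.2 (hj.trans_lt hi'))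
      · exact (ha j i hij).trans hi
  funext i
  apply le_antisymm
  · have : i ∈ Finset.univ.filter fun j => b j ≤ b i := by simp
    rw [← key] at this
    simpa using this
  · have : i ∈ Finset.univ.filter fun j => a j ≤ a i := by simp
    rw [key] at this
    simpa using this

open Classical in
lemma card_monoLabel_le [DecidableEq ι] {α : Type*} [LinearOrder α] (k : ℕ) (x : ι → α) :
    (Finset.univ.filter fun a : ι → Fin k => MonoLabel x a).card ≤ (Fintype.card ι + 1) ^ k := by
  have : (Fintype.card ι + 1) ^ k =
      (Finset.univ : Finset (Fin k → Fin (Fintype.card ι + 1))).card := by simp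
  rw [this]
  refine Finset.card_le_card_of_injOn (fun a s => ⟨(Finset.univ.filter fun i => a i ≤ s).card,
    Nat.lt_succ_of_le (Finset.card_le_univ _)⟩) (fun _ _ => by simp) ?_
  intro a ha b hb hab
  refine MonoLabel.eq_of_card_eq (Finset.mem_filter.1 ha).2 (Finset.mem_filter.1 hb).2 fun s => ?_
  simpa using congrFun hab s

end Monotone

end MINE

namespace MINE

-- The partitions produced by the algorithm are monotone and numbered without gaps.

section Equipartition

variable {n : ℕ} {α : Type*} [LinearOrder α]

lemma le_equipartitionLoop (v : Fin n → α) (m : ℕ) (l : List α) (placed h row : ℕ) (size : ℚ)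
    (x : α) : row ≤ equipartitionLoop v m l placed h row size x := by
  induction l generalizing placed h row size with
  | nil => simp [equipartitionLoop]
  | cons a l ih =>
    rw [equipartitionLoop]
    split_ifs
    · rcases eq_or_ne x a with rfl | hx
      · simp
      · rw [Function.update_of_ne hx]
        exact (Nat.le_succ _).trans (ih _ _ _ _)
    · rcases eq_or_ne x a with rfl | hx
      · simp
      · rw [Function.update_of_ne hx]
        exact ih _ _ _ _

lemma equipartitionLoop_mono (v : Fin n → α) (m : ℕ) (l : List α) (hl : l.Pairwise (· < ·))
    (placed h row : ℕ) (size : ℚ) {x y : α} (hx : x ∈ l) (hy : y ∈ l) (hxy : x ≤ y) :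
    equipartitionLoop v m l placed h row size x ≤ equipartitionLoop v m l placed h row size y := by
  induction l generalizing placed h row size with
  | nil => simp at hx
  | cons a l ih =>
    rw [List.pairwise_cons] at hl
    rw [equipartitionLoop]
    rcases eq_or_ne y a with rfl | hya
    · have : x = y := by
        rcases List.mem_cons.1 hx with h | h
        · exact h
        · exact absurd (hl.1 _ h) (not_lt.2 hxy)
      rw [this]
    have hyl := (List.mem_cons.1 hy).resolve_left hya
    rcases eq_or_ne x a with rfl | hxa
    · split_ifs <;> rw [Function.update_self, Function.update_of_ne hya] <;>
        exact le_equipartitionLoop _ _ _ _ _ _ _ _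
    · have hxl := (List.mem_cons.1 hx).resolve_left hxa
      split_ifs <;> rw [Function.update_of_ne hxa, Function.update_of_ne hya] <;>
        exact ih hl.2 _ _ _ _ hxl hyl

/-- The invariant `hsize` says that in the last row the desired size counts all points not yet
assigned. Adding a group then always comes strictly closer to it, so no further row is opened. -/
lemma equipartitionLoop_lt (v : Fin n → α) (m : ℕ) (l : List α) (placed h row : ℕ) (size : ℚ)
    (hpos : ∀ a ∈ l, 0 < mult v a) (hsum : placed + (l.map (mult v)).sum = n) (hrow : row < m)
    (hsize : row + 1 = m → size = n - placed + h) (x : α) :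
    equipartitionLoop v m l placed h row size x < m := by
  induction l generalizing placed h row size with
  | nil => simpa [equipartitionLoop]
  | cons a l ih =>
    rw [List.map_cons, List.sum_cons] at hsum
    have ha : (0 : ℚ) < mult v a := by exact_mod_cast hpos a (by simp)
    have hle : (placed : ℚ) + mult v a ≤ n := by
      have : placed + mult v a ≤ n := by omega
      exact_mod_cast this
    rw [equipartitionLoop]
    split_ifs with hc
    · have hrow' : row + 1 < m := by
        rcases (Nat.succ_le_of_lt hrow).lt_or_eq with h' | h'
        · exact h'
        · exfalso
          have h1 := hsize h'
          have h2 := hc.2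
          rw [abs_of_nonpos (by rw [h1]; linarith), abs_of_nonpos (by rw [h1]; linarith)] at h2
          linarith
      have key : equipartitionLoop v m l (placed + mult v a) (mult v a) (row + 1)
          (((n : ℚ) - (placed : ℚ)) / ((m : ℚ) - ((row : ℚ) + 1))) x < m := by
        refine ih (placed + mult v a) (mult v a) (row + 1) _
          (fun b hb => hpos b (List.mem_cons_of_mem _ hb)) (by omega) hrow' fun h2 => ?_
        have : (m : ℚ) - ((row : ℚ) + 1) = 1 := by rw [← h2]; push_cast; ring
        rw [this]
        push_cast
        ring
      rcases eq_or_ne x a with rfl | hx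
      · rwa [Function.update_self]
      · rw [Function.update_of_ne hx]
        exact key
    · rcases eq_or_ne x a with rfl | hx
      · rwa [Function.update_self]
      · rw [Function.update_of_ne hx]
        refine ih _ _ _ _ (fun b hb => hpos b (List.mem_cons_of_mem _ hb)) (by omega) hrow
          fun h2 => ?_
        rw [hsize h2]
        push_cast
        ring

/-- Row numbers grow by one at a time, so none is skipped. -/
lemma exists_equipartitionLoop_eq (v : Fin n → α) (m : ℕ) (l : List α) (hl : l.Nodup)
    (placed h row : ℕ) (size : ℚ) {x : α} (hx : x ∈ l) {r : ℕ} (hr : row < r)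
    (hrx : r ≤ equipartitionLoop v m l placed h row size x) :
    ∃ y ∈ l, equipartitionLoop v m l placed h row size y = r := by
  induction l generalizing placed h row size with
  | nil => simp at hx
  | cons a l ih =>
    rw [List.nodup_cons] at hl
    have hne : ∀ y ∈ l, y ≠ a := fun y hy h => hl.1 (h ▸ hy)
    rw [equipartitionLoop] at hrx ⊢
    split_ifs at hrx ⊢ with hc
    · rcases (Nat.succ_le_of_lt hr).eq_or_lt with h' | h'
      · exact ⟨a, by simp, by rw [Function.update_self]; exact h'⟩
      · rcases List.mem_cons.1 hx with rfl | hxl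
        · rw [Function.update_self] at hrx
          omega
        · rw [Function.update_of_ne (hne x hxl)] at hrx
          obtain ⟨y, hy, hyr⟩ := ih hl.2 _ _ _ _ hxl h' hrx
          exact ⟨y, List.mem_cons_of_mem _ hy, by rwa [Function.update_of_ne (hne y hy)]⟩
    · rcases List.mem_cons.1 hx with rfl | hxl
      · rw [Function.update_self] at hrx
        omega
      · rw [Function.update_of_ne (hne x hxl)] at hrx
        obtain ⟨y, hy, hyr⟩ := ih hl.2 _ _ _ _ hxl hr hrx
        exact ⟨y, List.mem_cons_of_mem _ hy, by rwa [Function.update_of_ne (hne y hy)]⟩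

lemma exists_equipartitionLoop_eq_row (v : Fin n → α) (m : ℕ) (l : List α) (hl : l ≠ [])
    (placed row : ℕ) (size : ℚ) : ∃ y ∈ l, equipartitionLoop v m l placed 0 row size y = row := by
  cases l with
  | nil => exact absurd rfl hl
  | cons a l => exact ⟨a, by simp, by rw [equipartitionLoop]; simp⟩

lemma mem_sort_image (v : Fin n → α) (a : α) :
    a ∈ (Finset.univ.image v).sort (· ≤ ·) ↔ ∃ i, v i = a := by
  simp

lemma monoLabel_equipartition (v : Fin n → α) (m : ℕ) : MonoLabel v (equipartition v m) := by
  intro i j hij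
  exact equipartitionLoop_mono v m _ (Finset.sortedLT_sort _).pairwise _ _ _ _
    ((mem_sort_image v _).2 ⟨i, rfl⟩) ((mem_sort_image v _).2 ⟨j, rfl⟩) hij

lemma equipartition_lt (v : Fin n → α) {m : ℕ} (hm : 0 < m) (i : Fin n) :
    equipartition v m i < m := by
  refine equipartitionLoop_lt v m _ _ _ _ _ ?_ ?_ hm ?_ _
  · intro a ha
    obtain ⟨j, rfl⟩ := (mem_sort_image v a).1 ha
    exact Finset.card_pos.2 ⟨j, by simp⟩
  · rw [zero_add, ← List.sum_toFinset _ (Finset.sort_nodup _ _), Finset.sort_toFinset]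
    have := Finset.card_eq_sum_card_image v (Finset.univ : Finset (Fin n))
    rw [Finset.card_univ, Fintype.card_fin] at this
    exact this.symm
  · intro h
    have : m = 1 := by omega
    simp [this]

lemma equipartition_lt_numParts (v : Fin n → α) (m : ℕ) (i : Fin n) :
    equipartition v m i < numParts (equipartition v m) := by
  have hi := (mem_sort_image v _).2 ⟨i, rfl⟩
  have hsub : Finset.range (equipartition v m i + 1) ⊆
      Finset.univ.image (equipartition v m) := by
    intro r hr
    have hr' : r ≤ equipartition v m i := Nat.lt_succ_iff.1 (Finset.mem_range.1 hr)
    have : ∃ y ∈ (Finset.univ.image v).sort (· ≤ ·),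
        equipartitionLoop v m ((Finset.univ.image v).sort (· ≤ ·)) 0 0 0 ((n : ℚ) / (m : ℚ)) y
          = r := by
      rcases Nat.eq_zero_or_pos r with rfl | h0
      · exact exists_equipartitionLoop_eq_row v m _ (List.ne_nil_of_mem hi) _ _ _
      · exact exists_equipartitionLoop_eq v m _ (Finset.sort_nodup _ _) _ _ _ _ hi h0 hr'
    obtain ⟨y, hy, rfl⟩ := this
    obtain ⟨j, rfl⟩ := (mem_sort_image v y).1 hy
    exact Finset.mem_image.2 ⟨j, Finset.mem_univ _, rfl⟩
  have := Finset.card_le_card hsub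
  rw [Finset.card_range] at this
  exact this

lemma monoLabel_clump (u : Fin n → α) (q : Fin n → ℕ) : MonoLabel u (clump u q) := by
  intro i j hij
  refine Finset.card_le_card fun b hb => ?_
  rw [Finset.mem_filter] at hb ⊢
  exact ⟨hb.1, hb.2.1.trans hij, hb.2.2⟩

/-- Each clump boundary up to `u i` is itself a sample value, and its clump number is its rank among
the boundaries. These numbers are distinct and positive; with the number `0` of the leftmost point,
one more clump number occurs than there are boundaries. -/
lemma clump_lt_numParts (u : Fin n → α) (q : Fin n → ℕ) (i : Fin n) :
    clump u q i < numParts (clump u q) := by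
  set S : α → Finset α := fun x => (Finset.univ.image u).filter fun b =>
    b ≤ x ∧ ∃ j, Neighbours u (u j) b ∧ ¬ SameRow u q (u j) b with hS
  have hcl : ∀ j, clump u q j = (S (u j)).card := fun j => rfl
  have hmemS : ∀ x b, b ∈ S x ↔ b ∈ Finset.univ.image u ∧
    b ≤ x ∧ ∃ j, Neighbours u (u j) b ∧ ¬ SameRow u q (u j) b := fun x b => Finset.mem_filter
  have hself : ∀ b ∈ S (u i), b ∈ S b := fun b hb => by
    rw [hmemS] at hb ⊢
    exact ⟨hb.1, le_rfl, hb.2.2⟩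
  have hinj : Set.InjOn (fun b => (S b).card) (S (u i)) := by
    have hlt : ∀ b ∈ S (u i), ∀ b' ∈ S (u i), b < b' → (S b).card < (S b').card := by
      intro b _ b' hb' hbb
      refine Finset.card_lt_card (Finset.ssubset_iff_subset_ne.2 ⟨?_, ?_⟩)
      · intro d hd
        rw [hmemS] at hd ⊢
        exact ⟨hd.1, hd.2.1.trans hbb.le, hd.2.2⟩
      · intro h
        have := hself b' hb'
        rw [← h, hmemS] at this
        exact absurd this.2.1 (not_le.2 hbb)
    intro b hb b' hb' h
    rcases lt_trichotomy b b' with h' | h' | h'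
    · exact absurd h (hlt b hb b' hb' h').ne
    · exact h'
    · exact absurd h (hlt b' hb' b hb h').ne'
  have hsub : insert 0 ((S (u i)).image fun b => (S b).card) ⊆
      Finset.univ.image (clump u q) := by
    intro r hr
    rcases Finset.mem_insert.1 hr with rfl | hr
    · obtain ⟨j, -, hj⟩ := Finset.exists_min_image Finset.univ u ⟨i, Finset.mem_univ i⟩
      refine Finset.mem_image.2 ⟨j, Finset.mem_univ j, ?_⟩
      rw [hcl, Finset.card_eq_zero, Finset.eq_empty_iff_forall_notMem]
      intro b hb
      rw [hmemS] at hb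
      obtain ⟨-, hbj, k, hk, -⟩ := hb
      exact absurd (hj k (Finset.mem_univ k)) (not_le.2 (hk.2.2.1.trans_le hbj))
    · obtain ⟨b, hb, rfl⟩ := Finset.mem_image.1 hr
      obtain ⟨j, -, rfl⟩ := Finset.mem_image.1 ((hmemS _ _).1 hb).1
      exact Finset.mem_image.2 ⟨j, Finset.mem_univ j, hcl j⟩
  have h0 : 0 ∉ (S (u i)).image fun b => (S b).card := by
    intro h
    obtain ⟨b, hb, hb0⟩ := Finset.mem_image.1 h
    rw [Finset.card_eq_zero] at hb0
    have := hself b hb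
    simp [hb0] at this
  have := Finset.card_le_card hsub
  rw [Finset.card_insert_of_notMem h0, Finset.card_image_of_injOn hinj, ← hcl] at this
  exact this

lemma superclump_lt_numParts (u : Fin n → α) (q : Fin n → ℕ) (kmax : ℕ) (i : Fin n) :
    superclump u q kmax i < numParts (superclump u q kmax) := by
  unfold superclump
  split_ifs
  · exact equipartition_lt_numParts _ _ _
  · exact clump_lt_numParts _ _ _

lemma monoLabel_superclump (u : Fin n → α) (q : Fin n → ℕ) (kmax : ℕ) :
    MonoLabel u (superclump u q kmax) := by
  unfold superclump
  split_ifs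
  · exact fun i j hij => monoLabel_equipartition _ _ i j (monoLabel_clump u q i j hij)
  · exact monoLabel_clump u q

end Equipartition

-- The dynamic programme returns the information of an actual grid.

section Optimize

variable {n : ℕ}

lemma exists_finMax_eq {ι β : Type*} [LinearOrder β] [Zero β] {s : Finset ι} (hs : s.Nonempty)
    (f : ι → β) : ∃ i ∈ s, finMax s f = f i := by
  unfold finMax
  rw [dif_pos hs]
  exact Finset.exists_mem_eq_sup' hs f

lemma colTerm_eq (P q : Fin n → ℕ) (s t : ℕ) :
    colTerm P q s t = ∑ i ∈ Finset.univ.filter (fun i => s ≤ P i ∧ P i < t),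
      Real.logb 2 ((cellCount P q s t (q i) : ℝ) / (colCount P s t : ℝ)) := by
  unfold colTerm
  rw [← Finset.sum_fiberwise_of_maps_to (t := Finset.univ.image q) (g := q)
    (fun i _ => Finset.mem_image_of_mem q (Finset.mem_univ i))]
  refine Finset.sum_congr rfl fun r _ => ?_
  rw [Finset.filter_filter, Finset.sum_congr rfl
    (g := fun _ => Real.logb 2 ((cellCount P q s t r : ℝ) / (colCount P s t : ℝ)))
    (fun i hi => by rw [(Finset.mem_filter.1 hi).2.2]), Finset.sum_const, nsmul_eq_mul]
  simp [cellCount, and_assoc]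

/-- Division by zero is harmless: if there is no point before `t`, the column from `s` to `t` is
empty too. -/
lemma colCount_mul_div (P q : Fin n → ℕ) {s t : ℕ} :
    (colCount P 0 t : ℝ) * (colTerm P q s t / colCount P 0 t) = colTerm P q s t := by
  rcases Nat.eq_zero_or_pos (colCount P 0 t) with h | h
  · have h' : ∀ i, ¬ (s ≤ P i ∧ P i < t) := by
      intro i hi
      rw [colCount, Finset.card_eq_zero, Finset.filter_eq_empty_iff] at h
      exact h (Finset.mem_univ i) ⟨Nat.zero_le _, hi.2⟩
    rw [h, colTerm_eq, Finset.filter_false_of_mem fun i _ => h' i]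
    simp
  · have : (colCount P 0 t : ℝ) ≠ 0 := by exact_mod_cast h.ne'
    field_simp

lemma colCount_mono (P : Fin n → ℕ) {s t : ℕ} (h : s ≤ t) : colCount P 0 s ≤ colCount P 0 t :=
  Finset.card_le_card fun i hi => by
    simp only [Finset.mem_filter, Finset.mem_univ, true_and, zero_le] at hi ⊢
    omega

/-- The dynamic programme returns the value of some grouping `g` of the (super)clumps into
columns. -/
lemma exists_dpTable_eq (P q : Fin n → ℕ) (l t : ℕ) :
    ∃ g : ℕ → ℕ, Monotone g ∧ (∀ p, g p ≤ l) ∧ (colCount P 0 t : ℝ) * dpTable P q l t =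
      ∑ i ∈ Finset.univ.filter (fun i => P i < t), Real.logb 2
        (((Finset.univ.filter fun j => P j < t ∧ g (P j) = g (P i) ∧ q j = q i).card : ℝ) /
          (Finset.univ.filter fun j => P j < t ∧ g (P j) = g (P i)).card) := by
  induction l generalizing t with
  | zero =>
    refine ⟨fun _ => 0, monotone_const, fun _ => le_rfl, ?_⟩
    rw [dpTable, colCount_mul_div, colTerm_eq]
    simp [cellCount, colCount]
  | succ l ih =>
    rw [dpTable]
    split_ifs with hlt
    swap
    · obtain ⟨g, hg, hgl, h⟩ := ih t
      exact ⟨g, hg, fun p => (hgl p).trans (Nat.le_succ l), h⟩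
    obtain ⟨s, hs, hmax⟩ := exists_finMax_eq (s := Finset.Icc (l + 1) t)
      (Finset.nonempty_Icc.2 (by omega)) fun s =>
        ((colCount P 0 s : ℝ) / (colCount P 0 t : ℝ)) * dpTable P q l s
          + colTerm P q s t / (colCount P 0 t : ℝ)
    have hst := (Finset.mem_Icc.1 hs).2
    obtain ⟨g, hg, hgl, h⟩ := ih s
    -- The new last column takes the label `l + 1`, above every value of `g`. This keeps the
    -- grouping monotone and the column separate from the earlier ones.
    refine ⟨fun p => if p < s then g p else l + 1, ?_, ?_, ?_⟩
    · intro p p' hpp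
      dsimp only
      split_ifs with h1 h2
      · exact hg hpp
      · exact (hgl p).trans (Nat.le_succ l)
      · omega
      · exact le_rfl
    · intro p
      dsimp only
      split_ifs
      · exact (hgl p).trans (Nat.le_succ l)
      · exact le_rfl
    rw [hmax, mul_add, colCount_mul_div]
    have h1 : (colCount P 0 t : ℝ) * ((colCount P 0 s : ℝ) / (colCount P 0 t : ℝ) *
        dpTable P q l s) = colCount P 0 s * dpTable P q l s := by
      rcases Nat.eq_zero_or_pos (colCount P 0 t) with h0 | h0
      · have := colCount_mono P hst
        have : colCount P 0 s = 0 := by omega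
        simp [this]
      · have : (colCount P 0 t : ℝ) ≠ 0 := by exact_mod_cast h0.ne'
        field_simp
    rw [h1, h, colTerm_eq, ← Finset.sum_filter_add_sum_filter_not
      (Finset.univ.filter fun i => P i < t) (fun i => P i < s), Finset.filter_filter,
      Finset.filter_filter]
    congr 1
    · have hset : (Finset.univ.filter fun i => P i < t ∧ P i < s) =
          Finset.univ.filter fun i => P i < s := Finset.filter_congr fun i _ => by omega
      rw [hset]
      refine Finset.sum_congr rfl fun i hi => ?_
      have his := (Finset.mem_filter.1 hi).2
      have hiff : ∀ j, (P j < t ∧ (if P j < s then g (P j) else l + 1) =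
          if P i < s then g (P i) else l + 1) ↔ (P j < s ∧ g (P j) = g (P i)) := by
        intro j
        have := hgl (P i)
        rw [if_pos his]
        split_ifs with hj
        · simp [hj, hj.trans_le hst]
        · simp only [hj, false_and, iff_false, not_and]
          omega
      simp only [← and_assoc, hiff]
    · have hset : (Finset.univ.filter fun i => P i < t ∧ ¬ P i < s) =
          Finset.univ.filter fun i => s ≤ P i ∧ P i < t := Finset.filter_congr fun i _ => by omega
      rw [hset]
      refine Finset.sum_congr rfl fun i hi => ?_
      have his := (Finset.mem_filter.1 hi).2
      have hiff : ∀ j, (P j < t ∧ (if P j < s then g (P j) else l + 1) =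
          if P i < s then g (P i) else l + 1) ↔ (s ≤ P j ∧ P j < t) := by
        intro j
        have := hgl (P j)
        rw [if_neg (not_lt.2 his.1)]
        split_ifs with hj <;> omega
      simp only [← and_assoc, hiff]
      simp only [cellCount, colCount, and_assoc]

lemma card_mul_rowEntropy (q : Fin n → ℕ) :
    (n : ℝ) * rowEntropy q = -∑ i, Real.logb 2 ((fiberCard q i : ℝ) / n) := by
  rcases Nat.eq_zero_or_pos n with rfl | hn
  · simp
  have hn' : (n : ℝ) ≠ 0 := by exact_mod_cast hn.ne'
  unfold rowEntropy
  rw [mul_neg, Finset.mul_sum, ← Finset.sum_fiberwise_of_maps_to (t := Finset.univ.image q)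
    (g := q) (fun i _ => Finset.mem_image_of_mem q (Finset.mem_univ i))]
  congr 1
  refine Finset.sum_congr rfl fun r _ => ?_
  rw [Finset.sum_congr rfl (g := fun _ => Real.logb 2 ((mult q r : ℝ) / n))
    (fun i hi => by rw [← (Finset.mem_filter.1 hi).2]; rfl), Finset.sum_const, nsmul_eq_mul]
  change _ = (mult q r : ℝ) * _
  field_simp

/-- The output of `ApproxMaxMI` is the empirical mutual information of some grid. -/
theorem exists_approxMaxMI_eq (u v : Fin n → ℝ) {x y : ℕ} (hx : 0 < x) (hy : 0 < y) (kmax : ℕ) :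
    ∃ (a : Fin n → Fin x) (b : Fin n → Fin y), MonoLabel u a ∧ MonoLabel v b ∧
      (n : ℝ) * approxMaxMI u v x y kmax = infoSum a b := by
  set q := equipartition v y with hq
  set P := superclump u q kmax with hP
  have hPlt : ∀ i, P i < numParts P := superclump_lt_numParts u q kmax
  obtain ⟨g, hg, hgl, h⟩ := exists_dpTable_eq P q (x - 1) (numParts P)
  refine ⟨fun i => ⟨g (P i), by have := hgl (P i); omega⟩,
    fun i => ⟨q i, equipartition_lt v hy i⟩, ?_, ?_, ?_⟩
  · exact fun i j hij => hg (monoLabel_superclump u q kmax i j hij)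
  · exact fun i j hij => monoLabel_equipartition v y i j hij
  -- Since the numbering has no gaps, the table entry at `numParts P` accounts for all points.
  have hcol : colCount P 0 (numParts P) = n := by
    simp [colCount, hPlt]
  rw [← infoSum_comp_of_injective (f := Fin.val) (g := Fin.val) Fin.val_injective
    Fin.val_injective]
  simp only [hcol, hPlt, true_and, Finset.filter_true] at h
  rw [approxMaxMI, ← hq, ← hP, mul_add, card_mul_rowEntropy, h, infoSum, neg_add_eq_sub,
    ← Finset.sum_sub_distrib]
  refine Finset.sum_congr rfl fun i _ => ?_
  have h0 : (0 : ℝ) < n := by exact_mod_cast i.pos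
  have h1 : (0 : ℝ) < fiberCard (fun j => g (P j)) i := by
    exact_mod_cast fiberCard_pos (fun j => g (P j)) i
  have h2 : (0 : ℝ) < fiberCard q i := by exact_mod_cast fiberCard_pos q i
  have h3 : (0 : ℝ) < fiberCard (fun j => (g (P j), q j)) i := by
    exact_mod_cast fiberCard_pos (fun j => (g (P j), q j)) i
  have e1 : (Finset.univ.filter fun j => g (P j) = g (P i)).card =
    fiberCard (fun j => g (P j)) i := rfl
  have e2 : (Finset.univ.filter fun j => g (P j) = g (P i) ∧ q j = q i).card =
    fiberCard (fun j => (g (P j), q j)) i := by simp [fiberCard]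
  rw [e1, e2, ← Real.logb_div (by positivity) (by positivity), Fintype.card_fin]
  congr 1
  field_simp

end Optimize

end MINE

namespace MINE

-- Tail bound for the maximal information over grids of one size.

section Probability

variable {ι : Type*} [Fintype ι]

lemma measurableSet_monoLabel {k : ℕ} (a : ι → Fin k) :
    MeasurableSet {x : ι → ℝ | MonoLabel x a} := by
  have : {x : ι → ℝ | MonoLabel x a} = ⋂ i, ⋂ j, {x | x i ≤ x j → a i ≤ a j} := by
    ext x; simp [MonoLabel]
  rw [this]
  refine MeasurableSet.iInter fun i => MeasurableSet.iInter fun j => ?_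
  by_cases h : a i ≤ a j
  · simp [h]
  · simp only [h, imp_false, not_le]
    exact measurableSet_lt (measurable_pi_apply j) (measurable_pi_apply i)

variable [DecidableEq ι]

/-- The left side is the expected number of monotone labelings. -/
lemma sum_measureReal_monoLabel_le (P : Measure (ι → ℝ)) [IsProbabilityMeasure P] (k : ℕ) :
    ∑ a : ι → Fin k, P.real {x | MonoLabel x a} ≤ ((Fintype.card ι : ℝ) + 1) ^ k := by
  classical
  have h1 : ∀ a : ι → Fin k, P.real {x | MonoLabel x a} =
      ∫ x, {x | MonoLabel x a}.indicator 1 x ∂P := fun a =>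
    (integral_indicator_one (measurableSet_monoLabel a)).symm
  have hint : ∀ a : ι → Fin k, Integrable ({x : ι → ℝ | MonoLabel x a}.indicator (1 : (ι → ℝ) → ℝ)) P :=
    fun a => (integrable_const (1 : ℝ)).indicator (measurableSet_monoLabel a)
  simp_rw [h1]
  rw [← integral_finsetSum _ fun a _ => hint a]
  have h2 : ∫ _x : ι → ℝ, ((Fintype.card ι : ℝ) + 1) ^ k ∂P = ((Fintype.card ι : ℝ) + 1) ^ k := by
    simp
  rw [← h2]
  refine integral_mono (integrable_finsetSum _ fun a _ => hint a) (integrable_const _) fun x => ?_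
  have h3 : ∑ a : ι → Fin k, {x | MonoLabel x a}.indicator (1 : (ι → ℝ) → ℝ) x =
      ((Finset.univ.filter fun a : ι → Fin k => MonoLabel x a).card : ℝ) := by
    rw [Finset.card_filter]
    push_cast
    refine Finset.sum_congr rfl fun a _ => ?_
    simp [Set.indicator_apply]
  change ∑ a : ι → Fin k, {x | MonoLabel x a}.indicator (1 : (ι → ℝ) → ℝ) x ≤ _
  rw [h3]
  exact_mod_cast card_monoLabel_le k x

omit [DecidableEq ι] in
lemma measureReal_monoLabel_perm (ν : Measure ℝ) [IsProbabilityMeasure ν] {k : ℕ} (b : ι → Fin k)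
    (σ : Equiv.Perm ι) :
    (Measure.pi fun _ : ι => ν).real {x | MonoLabel x fun i => b (σ i)} =
      (Measure.pi fun _ : ι => ν).real {x | MonoLabel x b} := by
  have hmp := measurePreserving_piCongrLeft (fun _ : ι => ν) σ
  unfold Measure.real
  rw [← hmp.measure_preimage (measurableSet_monoLabel b).nullMeasurableSet]
  congr 2
  ext x
  have hx : ∀ i, (MeasurableEquiv.piCongrLeft (fun _ : ι => ℝ) σ) x (σ i) = x i := fun i =>
    Equiv.piCongrLeft_apply_apply (fun _ : ι => ℝ) σ x i
  simp only [Set.mem_preimage, Set.mem_ofPred_eq, MonoLabel]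
  constructor
  · intro h i j hij
    obtain ⟨i, rfl⟩ := σ.surjective i
    obtain ⟨j, rfl⟩ := σ.surjective j
    rw [hx, hx] at hij
    exact h i j hij
  · intro h i j hij
    refine h (σ i) (σ j) ?_
    rwa [hx, hx]

/-- The weights are invariant under permuting the points, so the sum equals its average over all
`σ`, to which the permutation bound applies for each `b`. -/
lemma sum_mul_two_rpow_infoSum_le (ν : Measure ℝ) [IsProbabilityMeasure ν] {k l : ℕ}
    (a : ι → Fin k) :
    ∑ b : ι → Fin l, (Measure.pi fun _ : ι => ν).real {x | MonoLabel x b} * 2 ^ infoSum a b ≤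
      ((Fintype.card ι : ℝ) + 1) ^ l * ((Real.exp 1 * (Fintype.card ι + 1)) ^ l *
        ((Fintype.card ι : ℝ) + 1) ^ (k * l)) := by
  set w : (ι → Fin l) → ℝ := fun b => (Measure.pi fun _ : ι => ν).real {x | MonoLabel x b}
  set K : ℝ := (Real.exp 1 * (Fintype.card ι + 1)) ^ l * ((Fintype.card ι : ℝ) + 1) ^ (k * l)
  have hperm : ∀ σ : Equiv.Perm ι, ∑ b, w b * 2 ^ infoSum a b =
      ∑ b, w b * 2 ^ infoSum a (fun i => b (σ i)) := by
    intro σ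
    rw [← Equiv.sum_comp (Equiv.arrowCongr σ.symm (Equiv.refl (Fin l)))]
    refine Finset.sum_congr rfl fun b _ => ?_
    have : (Equiv.arrowCongr σ.symm (Equiv.refl (Fin l))) b = fun i => b (σ i) := by
      ext i; simp
    rw [this, show w (fun i => b (σ i)) = w b from measureReal_monoLabel_perm ν b σ]
  have hfac : (0 : ℝ) < (Fintype.card ι).factorial := by positivity
  have h1 : ((Fintype.card ι).factorial : ℝ) * ∑ b, w b * 2 ^ infoSum a b ≤
      (Fintype.card ι).factorial * (((Fintype.card ι : ℝ) + 1) ^ l * K) := by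
    calc ((Fintype.card ι).factorial : ℝ) * ∑ b, w b * 2 ^ infoSum a b
        = ∑ _σ : Equiv.Perm ι, ∑ b, w b * 2 ^ infoSum a b := by
          rw [Finset.sum_const, Finset.card_univ, Fintype.card_perm, nsmul_eq_mul]
      _ = ∑ σ : Equiv.Perm ι, ∑ b, w b * 2 ^ infoSum a (fun i => b (σ i)) :=
          Finset.sum_congr rfl fun σ _ => hperm σ
      _ = ∑ b, w b * ∑ σ : Equiv.Perm ι, (2 : ℝ) ^ infoSum a (fun i => b (σ i)) := by
          rw [Finset.sum_comm]
          simp_rw [Finset.mul_sum]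
      _ ≤ ∑ b, w b * ((Fintype.card ι).factorial * K) := by
          refine Finset.sum_le_sum fun b _ => mul_le_mul_of_nonneg_left ?_ measureReal_nonneg
          have := sum_perm_two_rpow_infoSum_le a b
          rwa [Fintype.card_fin, Fintype.card_fin, mul_assoc] at this
      _ = (Fintype.card ι).factorial * ((∑ b, w b) * K) := by
          rw [← Finset.sum_mul]; ring
      _ ≤ _ := by
          gcongr
          exact sum_measureReal_monoLabel_le _ l
  exact le_of_mul_le_mul_left h1 hfac

/-- The samples for which some `k`-by-`l` grid has large empirical mutual information. -/
def highInfo (ι : Type*) [Fintype ι] (k l : ℕ) (t : ℝ) : Set ((ι → ℝ) × (ι → ℝ)) :=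
  {z | ∃ (a : ι → Fin k) (b : ι → Fin l), MonoLabel z.1 a ∧ MonoLabel z.2 b ∧ t ≤ infoSum a b}

omit [DecidableEq ι] in
lemma highInfo_eq_iUnion (k l : ℕ) (t : ℝ) :
    highInfo ι k l t = ⋃ ab ∈ {ab : (ι → Fin k) × (ι → Fin l) | t ≤ infoSum ab.1 ab.2},
      {x | MonoLabel x ab.1} ×ˢ {y | MonoLabel y ab.2} := by
  ext z
  simp only [highInfo, Set.mem_ofPred_eq, Set.mem_iUnion, Set.mem_prod, Prod.exists, exists_prop]
  tauto

omit [DecidableEq ι] in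
lemma measurableSet_highInfo (k l : ℕ) (t : ℝ) : MeasurableSet (highInfo ι k l t) := by
  rw [highInfo_eq_iUnion]
  exact MeasurableSet.biUnion (Set.to_countable _) fun ab _ =>
    (measurableSet_monoLabel ab.1).prod (measurableSet_monoLabel ab.2)

theorem measureReal_highInfo_le (ν ν' : Measure ℝ) [IsProbabilityMeasure ν]
    [IsProbabilityMeasure ν'] (k l : ℕ) (t : ℝ) :
    ((Measure.pi fun _ : ι => ν).prod (Measure.pi fun _ : ι => ν')).real (highInfo ι k l t) ≤
      ((Fintype.card ι : ℝ) + 1) ^ k * (((Fintype.card ι : ℝ) + 1) ^ l *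
        ((Real.exp 1 * (Fintype.card ι + 1)) ^ l * ((Fintype.card ι : ℝ) + 1) ^ (k * l))) *
        2 ^ (-t) := by
  classical
  set P := Measure.pi fun _ : ι => ν
  set P' := Measure.pi fun _ : ι => ν'
  set S : Finset ((ι → Fin k) × (ι → Fin l)) :=
    Finset.univ.filter fun ab => t ≤ infoSum ab.1 ab.2
  have hS : highInfo ι k l t = ⋃ ab ∈ S, {x | MonoLabel x ab.1} ×ˢ {y | MonoLabel y ab.2} := by
    rw [highInfo_eq_iUnion]
    simp [S]
  rw [hS]
  calc (P.prod P').real (⋃ ab ∈ S, {x | MonoLabel x ab.1} ×ˢ {y | MonoLabel y ab.2})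
      ≤ ∑ ab ∈ S, (P.prod P').real ({x | MonoLabel x ab.1} ×ˢ {y | MonoLabel y ab.2}) :=
        measureReal_biUnion_finset_le _ _
    _ ≤ ∑ ab ∈ S, P.real {x | MonoLabel x ab.1} * (P'.real {y | MonoLabel y ab.2} *
          2 ^ infoSum ab.1 ab.2) * 2 ^ (-t) := by
        refine Finset.sum_le_sum fun ab hab => ?_
        rw [measureReal_prod_prod, ← mul_assoc, mul_assoc]
        -- Exponential Markov step: on the index set `S` the factor `2 ^ (infoSum - t)` is at least
        -- `1`.
        refine le_mul_of_one_le_right (by positivity) ?_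
        rw [← Real.rpow_add two_pos]
        exact Real.one_le_rpow one_le_two (by linarith [(Finset.mem_filter.1 hab).2])
    _ ≤ ∑ ab : (ι → Fin k) × (ι → Fin l), P.real {x | MonoLabel x ab.1} *
          (P'.real {y | MonoLabel y ab.2} * 2 ^ infoSum ab.1 ab.2) * 2 ^ (-t) :=
        Finset.sum_le_sum_of_subset_of_nonneg (Finset.subset_univ _) fun _ _ _ => by positivity
    _ = (∑ a : ι → Fin k, P.real {x | MonoLabel x a} * ∑ b : ι → Fin l,
          P'.real {y | MonoLabel y b} * 2 ^ infoSum a b) * 2 ^ (-t) := by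
        rw [← Finset.sum_mul, Fintype.sum_prod_type]
        simp_rw [Finset.mul_sum]
    _ ≤ (∑ a : ι → Fin k, P.real {x | MonoLabel x a} * (((Fintype.card ι : ℝ) + 1) ^ l *
          ((Real.exp 1 * (Fintype.card ι + 1)) ^ l *
            ((Fintype.card ι : ℝ) + 1) ^ (k * l)))) * 2 ^ (-t) := by
        gcongr with a
        exact sum_mul_two_rpow_infoSum_le ν' a
    _ ≤ _ := by
        rw [← Finset.sum_mul]
        gcongr
        exact sum_measureReal_monoLabel_le P k

end Probability

-- The joint law of the two coordinate samples.

section Law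

variable {Ω : Type*} [MeasurableSpace Ω] {μ : Measure Ω} [IsProbabilityMeasure μ]
  {X Y : ℕ → Ω → ℝ}

lemma map_sample_eq (hX : ∀ i, Measurable (X i)) (hY : ∀ i, Measurable (Y i))
    (hindep : iIndepFun (fun i ω => (X i ω, Y i ω)) μ)
    (hident : ∀ i, IdentDistrib (fun ω => (X i ω, Y i ω)) (fun ω => (X 0 ω, Y 0 ω)) μ μ)
    (hXY : IndepFun (X 0) (Y 0) μ) (n : ℕ) :
    μ.map (fun ω => ((fun i : Fin n => X i ω), (fun i : Fin n => Y i ω))) =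
      (Measure.pi fun _ : Fin n => μ.map (X 0)).prod (Measure.pi fun _ : Fin n => μ.map (Y 0)) := by
  have : IsProbabilityMeasure (μ.map (X 0)) := Measure.isProbabilityMeasure_map (hX 0).aemeasurable
  have : IsProbabilityMeasure (μ.map (Y 0)) := Measure.isProbabilityMeasure_map (hY 0).aemeasurable
  have hpair : ∀ i, Measurable fun ω => (X i ω, Y i ω) := fun i => (hX i).prodMk (hY i)
  have h1 := iIndepFun.map_fun_eq_pi_map (fun i : Fin n => (hpair i).aemeasurable)
    (hindep.precomp Fin.val_injective)
  have h2 : ∀ i : Fin n, μ.map (fun ω => (X i ω, Y i ω)) = (μ.map (X 0)).prod (μ.map (Y 0)) :=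
    fun i => by
      rw [(hident i).map_eq]
      exact (indepFun_iff_map_prod_eq_prod_map_map (hX 0).aemeasurable (hY 0).aemeasurable).1 hXY
  have h3 : μ.map (fun ω (i : Fin n) => (X i ω, Y i ω)) =
      Measure.pi fun _ : Fin n => (μ.map (X 0)).prod (μ.map (Y 0)) := by
    rw [← funext h2]
    exact h1
  have hmp := measurePreserving_arrowProdEquivProdArrow ℝ ℝ (Fin n)
    (fun _ => μ.map (X 0)) (fun _ => μ.map (Y 0))
  rw [← hmp.map_eq, ← h3, Measure.map_map hmp.measurable (measurable_pi_lambda _ fun i : Fin n => hpair i)]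
  rfl

end Law

-- The exponential decay beats the number of grids.

section Asymptotics

lemma tendsto_pow_mul_two_rpow {B : ℕ → ℝ} {ε : ℝ} (hε0 : 0 < ε)
    (hB : B =O[atTop] fun n : ℕ => (n : ℝ) ^ (1 - ε)) {δ : ℝ} (hδ : 0 < δ) :
    Tendsto (fun n : ℕ => (3 * ((n : ℝ) + 1)) ^ (6 * ⌊B n⌋₊) * (2 : ℝ) ^ (-((n : ℝ) * δ)))
      atTop (𝓝 0) := by
  have hlin : Tendsto (fun n : ℕ => 3 * ((n : ℝ) + 1)) atTop atTop :=
    (tendsto_atTop_add_const_right _ _ tendsto_natCast_atTop_atTop).const_mul_atTop (by norm_num)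
  have hlog : (fun n : ℕ => Real.log (3 * ((n : ℝ) + 1))) =o[atTop]
      fun n : ℕ => (n : ℝ) ^ ε := by
    refine ((isLittleO_log_rpow_atTop hε0).comp_tendsto hlin).trans_isBigO ?_
    refine Asymptotics.IsBigO.of_bound (6 ^ ε) ?_
    filter_upwards [eventually_ge_atTop 1] with n hn
    have hn' : (1 : ℝ) ≤ n := by exact_mod_cast hn
    rw [Function.comp, Real.norm_of_nonneg (by positivity), Real.norm_of_nonneg (by positivity),
      ← Real.mul_rpow (by norm_num) (by positivity)]
    exact Real.rpow_le_rpow (by positivity) (by linarith) hε0.le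
  have hmul : (fun n : ℕ => B n * Real.log (3 * ((n : ℝ) + 1))) =o[atTop] fun n : ℕ => (n : ℝ) := by
    refine (hB.mul_isLittleO hlog).congr' (EventuallyEq.refl _ _) ?_
    filter_upwards [eventually_ge_atTop 1] with n hn
    have hn' : (0 : ℝ) < n := by exact_mod_cast hn
    rw [← Real.rpow_add hn']
    simp
  have hl2 : 0 < Real.log 2 := Real.log_pos one_lt_two
  -- With the exponent `6 * ⌊B n⌋₊`, the constant `1/12` lets the prefactor use up half of the decay
  -- rate `δ log 2`.
  have hb := hmul.bound (c := δ * Real.log 2 / 12) (by positivity)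
  have hexp : Tendsto (fun n : ℕ => Real.exp (-(δ * Real.log 2 / 2 * n))) atTop (𝓝 0) :=
    Real.tendsto_exp_neg_atTop_nhds_zero.comp
      (tendsto_natCast_atTop_atTop.const_mul_atTop (by positivity))
  refine squeeze_zero' (Eventually.of_forall fun n => by positivity) ?_ hexp
  filter_upwards [hb] with n hn
  have hpos : (0 : ℝ) < 3 * ((n : ℝ) + 1) := by positivity
  have hlogpos : 0 ≤ Real.log (3 * ((n : ℝ) + 1)) :=
    Real.log_nonneg (by linarith [Nat.cast_nonneg (α := ℝ) n])
  have hfl : (⌊B n⌋₊ : ℝ) ≤ |B n| := by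
    rcases le_total 0 (B n) with h | h
    · exact (Nat.floor_le h).trans (le_abs_self _)
    · simp [Nat.floor_of_nonpos h]
  rw [norm_mul, Real.norm_eq_abs, Real.norm_of_nonneg hlogpos,
    Real.norm_of_nonneg (Nat.cast_nonneg n)] at hn
  have h1 : (⌊B n⌋₊ : ℝ) * Real.log (3 * ((n : ℝ) + 1)) ≤ δ * Real.log 2 / 12 * n :=
    (mul_le_mul_of_nonneg_right hfl hlogpos).trans hn
  rw [← Real.rpow_natCast, Real.rpow_def_of_pos hpos, Real.rpow_def_of_pos two_pos,
    ← Real.exp_add]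
  refine Real.exp_le_exp.2 ?_
  push_cast
  nlinarith

end Asymptotics

-- From single grids to the power mean.

section GMIC

lemma mem_gridSizes {N k l : ℕ} :
    (k, l) ∈ gridSizes N ↔ 2 ≤ k ∧ 2 ≤ l ∧ k * l ≤ N := by
  simp only [gridSizes, Finset.mem_filter, Finset.mem_product, Finset.mem_Icc]
  constructor
  · tauto
  · rintro ⟨hk, hl, h⟩
    refine ⟨⟨⟨hk, ?_⟩, hl, ?_⟩, h⟩ <;> nlinarith

lemma finMax_mem_Icc {ι : Type*} (s : Finset ι) (f : ι → ℝ) {δ : ℝ} (hδ : 0 ≤ δ)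
    (h : ∀ i ∈ s, f i ∈ Set.Icc 0 δ) : finMax s f ∈ Set.Icc 0 δ := by
  rcases s.eq_empty_or_nonempty with rfl | hs
  · simp [finMax, hδ]
  · obtain ⟨i, hi, hf⟩ := exists_finMax_eq hs f
    rw [hf]
    exact h i hi

lemma gmic_mem_Icc {p : ℝ≥0∞} (hp : 1 ≤ p) (b : ℝ) (C : ℕ → ℕ → ℝ) {δ : ℝ} (hδ : 0 ≤ δ)
    (h : ∀ k l, (k, l) ∈ gridSizes ⌊b⌋₊ → C k l ∈ Set.Icc 0 δ) : gmic p b C ∈ Set.Icc 0 δ := by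
  have hmax : ∀ ij ∈ gridSizes ⌊b⌋₊, maximalChar C ij.1 ij.2 ∈ Set.Icc 0 δ := by
    rintro ⟨i, j⟩ hij
    refine finMax_mem_Icc _ _ hδ ?_
    rintro ⟨k, l⟩ hkl
    rw [mem_gridSizes] at hij hkl
    exact h k l (mem_gridSizes.2 ⟨hkl.1, hkl.2.1, hkl.2.2.trans hij.2.2⟩)
  unfold gmic
  split_ifs with hpt
  · exact finMax_mem_Icc _ _ hδ hmax
  have hp0 : 0 < p.toReal := ENNReal.toReal_pos (zero_lt_one.trans_le hp).ne' hpt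
  have hnn : ∀ ij ∈ gridSizes ⌊b⌋₊, 0 ≤ maximalChar C ij.1 ij.2 ^ p.toReal := fun ij hij =>
    Real.rpow_nonneg (hmax ij hij).1 _
  have hmean : 0 ≤ (1 / ((gridSizes ⌊b⌋₊).card : ℝ)) *
      ∑ ij ∈ gridSizes ⌊b⌋₊, maximalChar C ij.1 ij.2 ^ p.toReal :=
    mul_nonneg (by positivity) (Finset.sum_nonneg hnn)
  refine ⟨Real.rpow_nonneg hmean _, ?_⟩
  rw [one_div p.toReal, Real.rpow_inv_le_iff_of_pos hmean hδ hp0, one_div_mul_eq_div]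
  -- This form also covers an empty set of grid sizes, where the quotient is `0`.
  refine div_le_of_le_mul₀ (by positivity) (by positivity) ?_
  refine (Finset.sum_le_card_nsmul _ _ (δ ^ p.toReal) fun ij hij =>
    Real.rpow_le_rpow (hmax ij hij).1 (hmax ij hij).2 hp0.le).trans (le_of_eq ?_)
  rw [nsmul_eq_mul, mul_comm]

lemma approxMaxMI_mem_Icc {n : ℕ} (hn : 0 < n) (u v : Fin n → ℝ) {x y : ℕ} (hx : 0 < x)
    (hy : 0 < y) (kmax : ℕ) {δ : ℝ} (h : (u, v) ∉ highInfo (Fin n) x y (n * δ)) :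
    approxMaxMI u v x y kmax ∈ Set.Icc 0 δ := by
  have hn' : (0 : ℝ) < n := by exact_mod_cast hn
  obtain ⟨a, b, ha, hb, hab⟩ := exists_approxMaxMI_eq u v hx hy kmax
  have h0 := infoSum_nonneg a b
  have h1 : infoSum a b < n * δ := by
    by_contra! hc
    exact h ⟨a, b, ha, hb, hc⟩
  rw [← hab] at h0 h1
  exact ⟨nonneg_of_mul_nonneg_right h0 hn', (lt_of_mul_lt_mul_left h1 hn'.le).le⟩

/-- By symmetry of the information, the transposed sample needs no event of its own. -/
lemma highInfo_swap {ι : Type*} [Fintype ι] {k l : ℕ} {t : ℝ} {u v : ι → ℝ}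
    (h : (v, u) ∈ highInfo ι l k t) : (u, v) ∈ highInfo ι k l t := by
  obtain ⟨a, b, ha, hb, hab⟩ := h
  exact ⟨b, a, hb, ha, infoSum_comm a b ▸ hab⟩

lemma approxGMIC_mem_Icc {n : ℕ} (hn : 0 < n) {p : ℝ≥0∞} (hp : 1 ≤ p) (b c : ℝ)
    (u v : Fin n → ℝ) {δ : ℝ} (hδ : 0 ≤ δ)
    (h : ∀ k l, (k, l) ∈ gridSizes ⌊b⌋₊ → (u, v) ∉ highInfo (Fin n) k l (n * δ)) :
    approxGMIC p b c u v ∈ Set.Icc 0 δ := by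
  refine gmic_mem_Icc hp b _ hδ fun k l hkl => ?_
  have hkl' := mem_gridSizes.1 hkl
  have h1 := approxMaxMI_mem_Icc hn u v (by omega : 0 < k) (by omega : 0 < l)
    (maxClumps c ⌊b / (l : ℝ)⌋₊) (h k l hkl)
  have h2 := approxMaxMI_mem_Icc hn v u (by omega : 0 < l) (by omega : 0 < k)
    (maxClumps c ⌊b / (k : ℝ)⌋₊) (fun hc => h k l hkl (highInfo_swap hc))
  -- As `k, l ≥ 2`, the normalisation can only decrease the entry.
  have hlog : 1 ≤ Real.logb 2 (min k l : ℕ) := by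
    rw [Real.le_logb_iff_rpow_le one_lt_two (by
      have : 0 < min k l := by omega
      exact_mod_cast this), Real.rpow_one]
    exact_mod_cast (le_min hkl'.1 hkl'.2.1)
  unfold approxChar
  exact ⟨div_nonneg (h1.1.trans (le_max_left _ _)) (zero_le_one.trans hlog),
    (div_le_self (h1.1.trans (le_max_left _ _)) hlog).trans (max_le h1.2 h2.2)⟩

/-- The base `3` comes from `e < 3`. In the exponent, `4` comes from the four powers in each summand
and `2` from the number of grid sizes. -/
lemma sum_gridSizes_le (n N : ℕ) :
    ∑ kl ∈ gridSizes N, ((n : ℝ) + 1) ^ kl.1 * (((n : ℝ) + 1) ^ kl.2 *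
      ((Real.exp 1 * (n + 1)) ^ kl.2 * ((n : ℝ) + 1) ^ (kl.1 * kl.2))) ≤
      (3 * ((n : ℝ) + 1)) ^ (6 * N) := by
  set M : ℝ := 3 * ((n : ℝ) + 1) with hM
  have hn : (0 : ℝ) ≤ n := Nat.cast_nonneg n
  have hM1 : 1 ≤ M := by linarith
  have he : Real.exp 1 ≤ 3 := by linarith [Real.exp_one_lt_d9]
  have hpow : ∀ {x : ℝ} {m : ℕ}, 0 ≤ x → x ≤ M → m ≤ N → x ^ m ≤ M ^ N := fun h0 h1 h2 =>
    (pow_le_pow_left₀ h0 h1 _).trans (pow_le_pow_right₀ hM1 h2)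
  have hterm : ∀ kl ∈ gridSizes N, ((n : ℝ) + 1) ^ kl.1 * (((n : ℝ) + 1) ^ kl.2 *
      ((Real.exp 1 * (n + 1)) ^ kl.2 * ((n : ℝ) + 1) ^ (kl.1 * kl.2))) ≤ M ^ (4 * N) := by
    rintro ⟨k, l⟩ hkl
    obtain ⟨hk, hl, h⟩ := mem_gridSizes.1 hkl
    have hkN : k ≤ N := by nlinarith
    have hlN : l ≤ N := by nlinarith
    have hx : (n : ℝ) + 1 ≤ M := by linarith
    have hy : Real.exp 1 * ((n : ℝ) + 1) ≤ M := by rw [hM]; gcongr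
    calc _ ≤ M ^ N * (M ^ N * (M ^ N * M ^ N)) := by
          gcongr
          · exact hpow (by positivity) hx hkN
          · exact hpow (by positivity) hx hlN
          · exact hpow (by positivity) hy hlN
          · exact hpow (by positivity) hx h
      _ = M ^ (4 * N) := by ring
  have hcard : ((gridSizes N).card : ℝ) ≤ M ^ (2 * N) := by
    have h1 : (gridSizes N).card ≤ N * N := by
      refine (Finset.card_filter_le _ _).trans ?_
      rw [Finset.card_product, Nat.card_Icc]
      exact Nat.mul_le_mul (by omega) (by omega)
    have h2 : (N : ℝ) ≤ M ^ N := by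
      have : (N : ℝ) ≤ 2 ^ N := by exact_mod_cast Nat.lt_two_pow_self.le
      exact this.trans (pow_le_pow_left₀ (by norm_num) (by linarith) _)
    calc ((gridSizes N).card : ℝ) ≤ N * N := by exact_mod_cast h1
      _ ≤ M ^ N * M ^ N := by gcongr
      _ = M ^ (2 * N) := by ring
  calc _ ≤ (gridSizes N).card • M ^ (4 * N) := Finset.sum_le_card_nsmul _ _ _ hterm
    _ ≤ M ^ (2 * N) * M ^ (4 * N) := by
        rw [nsmul_eq_mul]
        gcongr
    _ = M ^ (6 * N) := by ring

end GMIC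

end MINE

-- Convergence in probability.

theorem mainTheorem1 {Ω : Type*} [MeasurableSpace Ω] (μ : Measure Ω) [IsProbabilityMeasure μ]
    (X Y : ℕ → Ω → ℝ) (hX : ∀ i, Measurable (X i)) (hY : ∀ i, Measurable (Y i))
    (hindep : iIndepFun (fun i ω => (X i ω, Y i ω)) μ)
    (hident : ∀ i, IdentDistrib (fun ω => (X i ω, Y i ω)) (fun ω => (X 0 ω, Y 0 ω)) μ μ)
    (hsupp : ∀ᵐ ω ∂μ, X 0 ω ∈ Set.Icc (0 : ℝ) 1 ∧ Y 0 ω ∈ Set.Icc (0 : ℝ) 1)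
    (hXcont : ∀ a : ℝ, μ {ω | X 0 ω = a} = 0) (hYcont : ∀ a : ℝ, μ {ω | Y 0 ω = a} = 0)
    (hXY : IndepFun (X 0) (Y 0) μ)
    (B : ℕ → ℝ) (ε : ℝ) (hε0 : 0 < ε) (hε1 : ε < 1)
    (hB : B =O[atTop] fun n : ℕ => (n : ℝ) ^ (1 - ε))
    (c : ℝ) (hc : 0 < c) (p : ℝ≥0∞) (hp : 1 ≤ p) :
    TendstoInMeasure μ
      (fun (n : ℕ) (ω : Ω) =>
        MINE.approxGMIC p (B n) c (fun i : Fin n => X i ω) (fun i : Fin n => Y i ω))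
      atTop (fun _ => (0 : ℝ)) := by
  rw [tendstoInMeasure_iff_norm]
  intro δ hδ
  have hlim := ENNReal.tendsto_ofReal (MINE.tendsto_pow_mul_two_rpow hε0 hB (half_pos hδ))
  rw [ENNReal.ofReal_zero] at hlim
  refine tendsto_of_tendsto_of_tendsto_of_le_of_le' tendsto_const_nhds hlim
    (Eventually.of_forall fun _ => zero_le) ?_
  filter_upwards [eventually_gt_atTop 0] with n hn
  have hlaw := MINE.map_sample_eq hX hY hindep hident hXY n
  have : IsProbabilityMeasure (μ.map (X 0)) := Measure.isProbabilityMeasure_map (hX 0).aemeasurable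
  have : IsProbabilityMeasure (μ.map (Y 0)) := Measure.isProbabilityMeasure_map (hY 0).aemeasurable
  set Z : Ω → (Fin n → ℝ) × (Fin n → ℝ) :=
    fun ω => ((fun i : Fin n => X i ω), (fun i : Fin n => Y i ω)) with hZ
  have hZm : Measurable Z := (measurable_pi_lambda _ fun i : Fin n => hX i).prodMk
    (measurable_pi_lambda _ fun i : Fin n => hY i)
  -- The threshold is `δ / 2` because off the union the statistic is only bounded by the threshold,
  -- while the event to exclude is `δ ≤ ‖·‖`, with equality allowed.
  have hsub : {ω | δ ≤ ‖MINE.approxGMIC p (B n) c (fun i : Fin n => X i ω)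
      (fun i : Fin n => Y i ω) - 0‖} ⊆
      ⋃ kl ∈ MINE.gridSizes ⌊B n⌋₊, Z ⁻¹' MINE.highInfo (Fin n) kl.1 kl.2 (n * (δ / 2)) := by
    intro ω hω
    by_contra hc'
    simp only [Set.mem_iUnion, not_exists] at hc'
    have := MINE.approxGMIC_mem_Icc hn hp (B n) c (fun i : Fin n => X i ω)
      (fun i : Fin n => Y i ω) (half_pos hδ).le fun k l hkl => hc' (k, l) hkl
    rw [Set.mem_ofPred_eq, sub_zero, Real.norm_of_nonneg this.1] at hω
    linarith [this.2]
  refine (measure_mono hsub).trans ?_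
  rw [← ofReal_measureReal (measure_ne_top _ _)]
  refine ENNReal.ofReal_le_ofReal ((measureReal_biUnion_finset_le _ _).trans ?_)
  have hterm : ∀ kl ∈ MINE.gridSizes ⌊B n⌋₊,
      μ.real (Z ⁻¹' MINE.highInfo (Fin n) kl.1 kl.2 (n * (δ / 2))) ≤
      ((n : ℝ) + 1) ^ kl.1 * (((n : ℝ) + 1) ^ kl.2 * ((Real.exp 1 * (n + 1)) ^ kl.2 *
        ((n : ℝ) + 1) ^ (kl.1 * kl.2))) * 2 ^ (-((n : ℝ) * (δ / 2))) := by
    intro kl _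
    rw [← map_measureReal_apply hZm (MINE.measurableSet_highInfo _ _ _), hlaw]
    have := MINE.measureReal_highInfo_le (ι := Fin n) (μ.map (X 0)) (μ.map (Y 0)) kl.1 kl.2
      (n * (δ / 2))
    rwa [Fintype.card_fin] at this
  refine (Finset.sum_le_sum hterm).trans ?_
  rw [← Finset.sum_mul]
  exact mul_le_mul_of_nonneg_right (MINE.sum_gridSizes_le n _) (by positivity)
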